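/- Let $m_1,m_2\in\mathbb N$ and let $\Delta_{2m}=\bigoplus_{i=1}^m\begin{pmatrix}0&1\\-1&0\end{pmatrix}$. Let $$S=\begin{pmatrix}S_{11}&S_{12}\\S_{21}&S_{22}\end{pmatrix}\in\mathbb R^{(2m_1+2m_2)\times(2m_1+2m_2)},\qquad S_{ij}\in\mathbb R^{2m_i\times 2m_j},$$ be a symplectic matrix, i.e. $S\,\Delta_{2m_1+2m_2}\,S^T=\Delta_{2m_1+2m_2}$, which is also symmetric and positive definite. Consider the Brascamp–Lieb datum $\mathbf B=(B_1,B_2,B_1',B_2')$ with $$B_1=\begin{pmatrix}I_{2m_1}&0\end{pmatrix},\quad B_2=\begin{pmatrix}0&I_{2m_2}\end{pmatrix},\quad B_1'=\begin{pmatrix}S_{11}&S_{12}\end{pmatrix},\quad B_2'=\begin{pmatrix}S_{21}&S_{22}\end{pmatrix},$$ and $\mathbf p=\left(\tfrac12,\tfrac12,\tfrac12,\tfrac12\right)$. For a random variable $X$ in $\mathbb R^n$ with probability density $p$ with respect to $(2\pi)^{-n/2}\,\mathrm d^nx$, let $S(X)=-\mathbb E\ln p(X)$ be its Shannon differential entropy,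 and let $$f(\mathbf B,\mathbf p)=\sup_X\Big(S(X)-\tfrac12S(B_1X)-\tfrac12S(B_2X)-\tfrac12S(B_1'X)-\tfrac12S(B_2'X)\Big)$$ be the (classical) Brascamp–Lieb constant, where the supremum is over all random variables $X$ in $\mathbb R^{2m_1+2m_2}$ with a density and finite entropy $S(X)$ for which the expression is well defined in $[-\infty,\infty]$ (i.e. all the entropies exist in $[-\infty,\infty]$ and $\infty-\infty$ does not occur). Then $$f(\mathbf B,\mathbf p)=-\frac12\ln\left(\det S_{11}\,\det S_{22}\right).$$ -/

import Mathlib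

open MeasureTheory
open scoped NNReal ENNReal Matrix

noncomputable section

namespace BrascampLieb

/-- The reference measure `(2π)^(-n/2) dⁿx` on `ℝⁿ` (here `ℝⁿ` is `ι → ℝ` with `n = |ι|`). -/
def refMeasure (ι : Type) [Fintype ι] : Measure (ι → ℝ) :=
  ENNReal.ofReal ((2 * Real.pi) ^ (-(Fintype.card ι : ℝ) / 2)) • volume

/-- For a random variable `X` with law `μ` and density `p` with respect to `refMeasure`,
the integrand `-ln p` of the Shannon differential entropy. -/
def negLogDensity {ι : Type} [Fintype ι] (μ : Measure (ι → ℝ)) (x : ι → ℝ) : ℝ :=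
  -Real.log (μ.rnDeriv (refMeasure ι) x).toReal

/-- The expectation of the positive part of `-ln p(X)`. -/
def entropyPos {ι : Type} [Fintype ι] (μ : Measure (ι → ℝ)) : ℝ≥0∞ :=
  ∫⁻ x, ENNReal.ofReal (negLogDensity μ x) ∂μ

/-- The expectation of the negative part of `-ln p(X)`. -/
def entropyNeg {ι : Type} [Fintype ι] (μ : Measure (ι → ℝ)) : ℝ≥0∞ :=
  ∫⁻ x, ENNReal.ofReal (-negLogDensity μ x) ∂μ

/-- The Shannon differential entropy `S(X) = -E ln p(X)` of a random variable with the
absolutely continuous law `μ`, as an extended real number. It is meaningful if `entropyPos μ`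
and `entropyNeg μ` are not both infinite. -/
def entropy {ι : Type} [Fintype ι] (μ : Measure (ι → ℝ)) : EReal :=
  (entropyPos μ : EReal) - (entropyNeg μ : EReal)

/-- `μ` is the law of a random variable that has a probability density and whose Shannon
differential entropy is finite. -/
structure HasFiniteEntropy {ι : Type} [Fintype ι] (μ : Measure (ι → ℝ)) : Prop where
  isProbabilityMeasure : IsProbabilityMeasure μ
  absolutelyContinuous : μ ≪ refMeasure ι
  entropyPos_ne_top : entropyPos μ ≠ ∞
  entropyNeg_ne_top : entropyNeg μ ≠ ∞

/-- A Brascamp–Lieb datum `(B₁, …, B_K)` on `ℝⁿ = (ι → ℝ)`: each `B_i` is an `n_i × n` real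
matrix of rank `n_i`. -/
structure Datum (ι : Type) [Fintype ι] (K : ℕ) where
  dim : Fin K → ℕ
  mat : (i : Fin K) → Matrix (Fin (dim i)) ι ℝ
  rank_mat : ∀ i, (mat i).rank = dim i

namespace Datum

variable {ι : Type} [Fintype ι] {K : ℕ}

/-- The law of `B_i X`, where `X` has law `μ`. It is absolutely continuous if `μ` is, because
`B_i` has full row rank. -/
def law (B : Datum ι K) (μ : Measure (ι → ℝ)) (i : Fin K) : Measure (Fin (B.dim i) → ℝ) :=
  μ.map fun x => B.mat i *ᵥ x

/-- `X` (with law `μ`) has finite entropy, and the extended real number `∑ i, p_i S(B_i X)` is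
well defined: every `S(B_i X)` with `p_i ≠ 0` exists in `[-∞, ∞]`, and the values `∞` and `-∞`
do not both occur among them. -/
def Admissible (B : Datum ι K) (p : Fin K → ℝ≥0) (μ : Measure (ι → ℝ)) : Prop :=
  HasFiniteEntropy μ ∧
    ((∀ i, p i ≠ 0 → entropyPos (B.law μ i) ≠ ∞) ∨
      (∀ i, p i ≠ 0 → entropyNeg (B.law μ i) ≠ ∞))

/-- The (classical) Brascamp–Lieb constant
`f(B, p) = sup_X (S(X) - ∑ i, p_i S(B_i X))`, an extended real number. -/
def constant (B : Datum ι K) (p : Fin K → ℝ≥0) : EReal :=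
  ⨆ (μ : Measure (ι → ℝ)) (_ : B.Admissible p μ),
    (entropy μ - ∑ i, ((p i : ℝ) : EReal) * entropy (B.law μ i))

end Datum

/-- The matrix `Δ_{2m}`, the direct sum of `m` blocks `!![0, 1; -1, 0]`. -/
def symplecticForm (m : ℕ) : Matrix (Fin (2 * m)) (Fin (2 * m)) ℝ :=
  Matrix.of fun i j =>
    if (i : ℕ) % 2 = 0 ∧ (j : ℕ) = i + 1 then 1
    else if (j : ℕ) % 2 = 0 ∧ (i : ℕ) = j + 1 then -1
    else 0

/-- The matrix `Δ_{2m₁+2m₂} = Δ_{2m₁} ⊕ Δ_{2m₂}`. -/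
def symplecticForm₂ (m₁ m₂ : ℕ) :
    Matrix (Fin (2 * m₁) ⊕ Fin (2 * m₂)) (Fin (2 * m₁) ⊕ Fin (2 * m₂)) ℝ :=
  Matrix.fromBlocks (symplecticForm m₁) 0 0 (symplecticForm m₂)

/-- `S` is a symplectic matrix: `S Δ Sᵀ = Δ`. -/
def IsSymplectic {m₁ m₂ : ℕ}
    (S : Matrix (Fin (2 * m₁) ⊕ Fin (2 * m₂)) (Fin (2 * m₁) ⊕ Fin (2 * m₂)) ℝ) : Prop :=
  S * symplecticForm₂ m₁ m₂ * Sᵀ = symplecticForm₂ m₁ m₂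

theorem symplecticForm_mul_transpose (m : ℕ) :
    symplecticForm m * (symplecticForm m)ᵀ = 1 := by
  ext i j
  have hi := i.isLt
  have hj := j.isLt
  rw [Matrix.mul_apply]
  by_cases h : (i : ℕ) % 2 = 0
  · rw [Finset.sum_eq_single (⟨i + 1, by omega⟩ : Fin (2 * m))]
    · simp only [symplecticForm, Matrix.transpose_apply, Matrix.of_apply, Matrix.one_apply,
        Fin.ext_iff]
      split_ifs <;> first | (exfalso; omega) | (norm_num; done) | simp_all
    · intro k _ hk
      have hk' : (k : ℕ) ≠ i + 1 := fun e => hk (Fin.ext e)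
      have : symplecticForm m i k = 0 := by
        simp only [symplecticForm, Matrix.of_apply]
        split_ifs <;> first | rfl | omega
      rw [this, zero_mul]
    · simp
  · rw [Finset.sum_eq_single (⟨i - 1, by omega⟩ : Fin (2 * m))]
    · simp only [symplecticForm, Matrix.transpose_apply, Matrix.of_apply, Matrix.one_apply,
        Fin.ext_iff]
      split_ifs <;> first | (exfalso; omega) | norm_num
    · intro k _ hk
      have hk' : (k : ℕ) ≠ i - 1 := fun e => hk (Fin.ext e)
      have : symplecticForm m i k = 0 := by
        simp only [symplecticForm, Matrix.of_apply]
        split_ifs <;> first | rfl | omega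
      rw [this, zero_mul]
    · simp

theorem IsSymplectic.isUnit {m₁ m₂ : ℕ}
    {S : Matrix (Fin (2 * m₁) ⊕ Fin (2 * m₂)) (Fin (2 * m₁) ⊕ Fin (2 * m₂)) ℝ}
    (hS : IsSymplectic S) : IsUnit S := by
  have h1 : symplecticForm₂ m₁ m₂ * (symplecticForm₂ m₁ m₂)ᵀ = 1 := by
    simp [symplecticForm₂, Matrix.fromBlocks_transpose, Matrix.fromBlocks_multiply,
      symplecticForm_mul_transpose]
  have h2 : S * (symplecticForm₂ m₁ m₂ * Sᵀ * (symplecticForm₂ m₁ m₂)ᵀ) = 1 := by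
    rw [← mul_assoc, ← mul_assoc, hS, h1]
  exact IsUnit.of_mul_eq_one _ h2

theorem rank_submatrix_of_isUnit {ι κ : Type} [Fintype ι] [DecidableEq ι] [Fintype κ]
    {S : Matrix ι ι ℝ} (hS : IsUnit S) {e : κ → ι} (he : Function.Injective e)
    {A : Matrix κ ι ℝ} (hA : ∀ i j, A i j = S (e i) j) : A.rank = Fintype.card κ := by
  apply LinearIndependent.rank_matrix
  have h : A.row = S.row ∘ e := by
    ext i j
    exact hA i j
  rw [h]
  exact (Matrix.linearIndependent_rows_of_isUnit hS).comp e he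

/-- For a symplectic matrix `S` with blocks `S₁₁, S₁₂, S₂₁, S₂₂`, the datum
`B₁ = (I 0)`, `B₂ = (0 I)`, `B₁' = (S₁₁ S₁₂)`, `B₂' = (S₂₁ S₂₂)`. -/
def symplecticDatum {m₁ m₂ : ℕ}
    (S : Matrix (Fin (2 * m₁) ⊕ Fin (2 * m₂)) (Fin (2 * m₁) ⊕ Fin (2 * m₂)) ℝ)
    (hS : IsSymplectic S) : Datum (Fin (2 * m₁) ⊕ Fin (2 * m₂)) 4 where
  dim := ![2 * m₁, 2 * m₂, 2 * m₁, 2 * m₂]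
  mat := fun i => match i with
    | 0 => (Matrix.fromCols 1 0 : Matrix (Fin (2 * m₁)) _ ℝ)
    | 1 => (Matrix.fromCols 0 1 : Matrix (Fin (2 * m₂)) _ ℝ)
    | 2 => Matrix.fromCols S.toBlocks₁₁ S.toBlocks₁₂
    | 3 => Matrix.fromCols S.toBlocks₂₁ S.toBlocks₂₂
  rank_mat := fun i => match i with
    | 0 => (rank_submatrix_of_isUnit (S := Matrix.fromBlocks 1 0 0 1)
        (by rw [Matrix.fromBlocks_one]; exact isUnit_one) Sum.inl_injective (by
        rintro i (j | j) <;> rfl)).trans (Fintype.card_fin _)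
    | 1 => (rank_submatrix_of_isUnit (S := Matrix.fromBlocks 1 0 0 1)
        (by rw [Matrix.fromBlocks_one]; exact isUnit_one) Sum.inr_injective (by
        rintro i (j | j) <;> rfl)).trans (Fintype.card_fin _)
    | 2 => (rank_submatrix_of_isUnit hS.isUnit Sum.inl_injective (by
        rintro i (j | j) <;> rfl)).trans (Fintype.card_fin _)
    | 3 => (rank_submatrix_of_isUnit hS.isUnit Sum.inr_injective (by
        rintro i (j | j) <;> rfl)).trans (Fintype.card_fin _)

end BrascampLieb

end

/-!
The four maps of the datum form two complementary pairs: `x ↦ (B₁ x, B₂' x) = (x₁, (S x)₂)` and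
`x ↦ (B₁' x, B₂ x) = ((S x)₁, x₂)` are linear changes of variables with determinants `det S₂₂` and
`det S₁₁`. Since all exponents are `1/2`, the product in the Brascamp–Lieb inequality for functions
is `√(f₁(B₁ x) f₂'(B₂' x)) · √(f₁'(B₁' x) f₂(B₂ x))`, and the Cauchy–Schwarz inequality bounds its
integral by `(det S₁₁ det S₂₂)^(-1/2)` times the product of the `(∫ f)^(1/2)`
(`Splits.lintegral_sqrt_mul_le`). Applied to the marginal densities of `X`, this gives the upper
bound for entropies by Jensen's inequality (`Datum.constant_le_of_lintegral_le`). That lemma also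
takes care of infinite entropies: once `S(X)` and the positive parts of the `S(Bᵢ X)` are finite,
so are the negative parts, hence `+∞` is never attained.

The bound is attained by the centred Gaussian law with density proportional to `exp(-xᵀ S x / 2)`.
Completing the square in either block writes `xᵀ S x` as a quadratic form in `B₁ x` plus one in
`B₂' x`, and as a quadratic form in `B₂ x` plus one in `B₁' x`. Therefore all four marginals are
Gaussian, with precision matrices the two Schur complements of `S` and `S₁₁⁻¹`, `S₂₂⁻¹`
(`map_gaussian`), and the quadratic terms of the entropies cancel. The symplectic condition enters
only through `det S = 1`, which makes the determinants of the Schur complements equal to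
`1 / det S₁₁` and `1 / det S₂₂`.
-/

/-! ### From inequalities for functions to inequalities for entropies -/

namespace BrascampLieb

section Entropy

variable {ι : Type} [Fintype ι]

instance instSigmaFiniteRefMeasure : SigmaFinite (refMeasure ι) := by
  unfold refMeasure
  exact inferInstanceAs (SigmaFinite
    ((Real.toNNReal ((2 * Real.pi) ^ (-(Fintype.card ι : ℝ) / 2))) • (volume : Measure (ι → ℝ))))

lemma measurable_mulVec {κ : Type*} (M : Matrix κ ι ℝ) : Measurable fun x : ι → ℝ => M *ᵥ x := by
  refine measurable_pi_lambda _ fun i => ?_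
  simp only [Matrix.mulVec, dotProduct]
  fun_prop

lemma measurable_negLogDensity (μ : Measure (ι → ℝ)) : Measurable (negLogDensity μ) :=
  (Real.measurable_log.comp (Measure.measurable_rnDeriv _ _).ennreal_toReal).neg

lemma integrable_max_zero {Ω : Type*} [MeasurableSpace Ω] {μ : Measure Ω} {f : Ω → ℝ}
    (hf : Measurable f) (h : ∫⁻ x, ENNReal.ofReal (f x) ∂μ ≠ ∞) :
    Integrable (fun x => max (f x) 0) μ := by
  refine ⟨(hf.max measurable_const).aestronglyMeasurable, ?_⟩
  rw [hasFiniteIntegral_iff_ofReal (.of_forall fun x => le_max_right (f x) 0)]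
  simpa [ENNReal.ofReal_max] using h.lt_top

lemma integrable_of_lintegral_ofReal_ne_top {Ω : Type*} [MeasurableSpace Ω] {μ : Measure Ω}
    {f : Ω → ℝ} (hf : Measurable f) (h₁ : ∫⁻ x, ENNReal.ofReal (f x) ∂μ ≠ ∞)
    (h₂ : ∫⁻ x, ENNReal.ofReal (-f x) ∂μ ≠ ∞) : Integrable f μ := by
  refine ((integrable_max_zero hf h₁).sub (integrable_max_zero hf.neg h₂)).congr
    (.of_forall fun x => ?_)
  simp only [Pi.sub_apply, Pi.neg_apply]
  rcases le_total (f x) 0 with h | h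
  · rw [max_eq_right h, max_eq_left (by linarith)]; ring
  · rw [max_eq_left h, max_eq_right (by linarith)]; ring

lemma entropy_eq_integral {μ : Measure (ι → ℝ)} (h₁ : entropyPos μ ≠ ∞) (h₂ : entropyNeg μ ≠ ∞) :
    entropy μ = ((∫ x, negLogDensity μ x ∂μ : ℝ) : EReal) := by
  rw [integral_eq_lintegral_pos_part_sub_lintegral_neg_part
    (integrable_of_lintegral_ofReal_ne_top (measurable_negLogDensity μ) h₁ h₂), EReal.coe_sub]
  change _ = ((entropyPos μ).toReal : EReal) - ((entropyNeg μ).toReal : EReal)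
  rw [EReal.coe_ennreal_toReal h₁, EReal.coe_ennreal_toReal h₂, entropy]

end Entropy

section Gibbs

variable {Ω κ : Type*} [MeasurableSpace Ω] [Fintype κ] {μ : Measure Ω}
  {h : Ω → ℝ} {a : κ → Ω → ℝ} {p : κ → ℝ≥0} {C : ℝ}

/-- Under an exponential moment bound on `h - ∑ i, p i * a i`, the negative parts of the `a i` are
integrable as soon as `h` and the positive parts are. This excludes the value `+∞` for the
difference of entropies. -/
lemma lintegral_ofReal_neg_ne_top [IsProbabilityMeasure μ] (hp : ∀ i, p i ≠ 0)
    (ha : ∀ i, Measurable (a i)) (hh : Integrable h μ) (hm : Measurable h)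
    (hexp : ∫⁻ x, ENNReal.ofReal (Real.exp (h x - ∑ i, (p i : ℝ) * a i x - C)) ∂μ ≤ 1)
    (hpos : ∀ i, ∫⁻ x, ENNReal.ofReal (a i x) ∂μ ≠ ∞) (j : κ) :
    ∫⁻ x, ENNReal.ofReal (-a j x) ∂μ ≠ ∞ := by
  have hE : Integrable (fun x => Real.exp (h x - ∑ i, (p i : ℝ) * a i x - C)) μ := by
    refine ⟨(Measurable.exp (by fun_prop)).aestronglyMeasurable, ?_⟩
    rw [hasFiniteIntegral_iff_ofReal (.of_forall fun x => (Real.exp_pos _).le)]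
    exact hexp.trans_lt ENNReal.one_lt_top
  have hG : Integrable (fun x => ∑ i, (p i : ℝ) * max (a i x) 0 + |h x| + |C| +
      Real.exp (h x - ∑ i, (p i : ℝ) * a i x - C)) μ :=
    (((integrable_finsetSum _ fun i _ =>
      (integrable_max_zero (ha i) (hpos i)).const_mul _).add hh.abs).add
      (integrable_const _)).add hE
  have hj : Integrable (fun x => (p j : ℝ) * max (-a j x) 0) μ := by
    refine hG.mono' (((ha j).neg.max measurable_const).const_mul _).aestronglyMeasurable
      (.of_forall fun x => ?_)
    rw [Real.norm_of_nonneg (by positivity)]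
    have h1 := Real.add_one_le_exp (h x - ∑ i, (p i : ℝ) * a i x - C)
    have h2 : (p j : ℝ) * max (-a j x) 0 ≤ ∑ i, (p i : ℝ) * max (-a i x) 0 :=
      Finset.single_le_sum (f := fun i => (p i : ℝ) * max (-a i x) 0)
        (fun i _ => by positivity) (Finset.mem_univ j)
    have h3 : ∑ i, (p i : ℝ) * a i x =
        ∑ i, (p i : ℝ) * max (a i x) 0 - ∑ i, (p i : ℝ) * max (-a i x) 0 := by
      rw [← Finset.sum_sub_distrib]
      refine Finset.sum_congr rfl fun i _ => ?_
      rcases le_total (a i x) 0 with h | h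
      · rw [max_eq_right h, max_eq_left (by linarith)]; ring
      · rw [max_eq_left h, max_eq_right (by linarith)]; ring
    linarith [neg_abs_le (h x), le_abs_self C]
  have hpj : (p j : ℝ) ≠ 0 := by exact_mod_cast hp j
  have hj' : Integrable (fun x => max (-a j x) 0) μ :=
    (hj.const_mul (p j : ℝ)⁻¹).congr (.of_forall fun x => by field_simp)
  have := (hasFiniteIntegral_iff_ofReal (.of_forall fun x => le_max_right (-a j x) 0)).1 hj'.2
  simpa [ENNReal.ofReal_max] using this.ne

lemma integral_sub_sum_le [IsProbabilityMeasure μ] (ha : ∀ i, Integrable (a i) μ)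
    (hh : Integrable h μ)
    (hexp : ∫⁻ x, ENNReal.ofReal (Real.exp (h x - ∑ i, (p i : ℝ) * a i x - C)) ∂μ ≤ 1) :
    ∫ x, h x ∂μ - ∑ i, (p i : ℝ) * ∫ x, a i x ∂μ ≤ C := by
  have hS : Integrable (fun x => ∑ i, (p i : ℝ) * a i x) μ :=
    integrable_finsetSum _ fun i _ => (ha i).const_mul _
  have hD : Integrable (fun x => h x - ∑ i, (p i : ℝ) * a i x - C) μ :=
    (hh.sub hS).sub (integrable_const _)
  have hE : Integrable (fun x => Real.exp (h x - ∑ i, (p i : ℝ) * a i x - C)) μ := by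
    refine ⟨(Real.measurable_exp.comp_aemeasurable hD.aemeasurable).aestronglyMeasurable, ?_⟩
    rw [hasFiniteIntegral_iff_ofReal (.of_forall fun x => (Real.exp_pos _).le)]
    exact hexp.trans_lt ENNReal.one_lt_top
  have h1 : ∫ x, (h x - ∑ i, (p i : ℝ) * a i x - C) ∂μ ≤
      ∫ x, (Real.exp (h x - ∑ i, (p i : ℝ) * a i x - C) - 1) ∂μ :=
    integral_mono hD (hE.sub (integrable_const _)) fun x => by
      have := Real.add_one_le_exp (h x - ∑ i, (p i : ℝ) * a i x - C)
      dsimp only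
      linarith
  have h2 : ∫ x, Real.exp (h x - ∑ i, (p i : ℝ) * a i x - C) ∂μ ≤ 1 := by
    rw [integral_eq_lintegral_of_nonneg_ae (.of_forall fun x => (Real.exp_pos _).le) hE.1]
    exact ENNReal.toReal_le_of_le_ofReal zero_le_one (by simpa using hexp)
  rw [integral_sub hE (integrable_const _), integral_sub (f := fun x => h x - ∑ i, (p i : ℝ) * a i x) (hh.sub hS)
    (integrable_const _), integral_sub hh hS, integral_finsetSum _ fun i _ => (ha i).const_mul _] at h1
  simp only [integral_const_mul, integral_const, probReal_univ, one_smul] at h1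
  linarith

end Gibbs

lemma EReal_coe_sum {κ : Type*} (s : Finset κ) (f : κ → ℝ) :
    ((∑ i ∈ s, f i : ℝ) : EReal) = ∑ i ∈ s, (f i : EReal) := by
  classical
  induction s using Finset.induction_on with
  | empty => simp
  | insert a s ha ih => rw [Finset.sum_insert ha, Finset.sum_insert ha, EReal.coe_add, ih]

lemma EReal_sum_ne_bot {κ : Type*} (s : Finset κ) {f : κ → EReal} (h : ∀ i ∈ s, f i ≠ ⊥) :
    ∑ i ∈ s, f i ≠ ⊥ := by
  classical
  induction s using Finset.induction_on with
  | empty => simp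
  | insert a s ha ih =>
    rw [Finset.sum_insert ha, Ne, EReal.add_eq_bot_iff, not_or]
    exact ⟨h a (Finset.mem_insert_self a s), ih fun i hi => h i (Finset.mem_insert_of_mem hi)⟩

lemma EReal_sum_eq_top {κ : Type*} {s : Finset κ} {f : κ → EReal} (h : ∀ i ∈ s, f i ≠ ⊥)
    {j : κ} (hj : j ∈ s) (hjt : f j = ⊤) : ∑ i ∈ s, f i = ⊤ := by
  classical
  rw [← Finset.add_sum_erase s f hj, hjt]
  exact EReal.top_add_of_ne_bot
    (EReal_sum_ne_bot _ fun i hi => h i (Finset.mem_of_mem_erase hi))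

namespace Datum

variable {ι : Type} [Fintype ι] {K : ℕ} (B : Datum ι K)

lemma law_absolutelyContinuous {μ : Measure (ι → ℝ)} (hμ : μ ≪ refMeasure ι) (i : Fin K) :
    B.law μ i ≪ refMeasure (Fin (B.dim i)) := by
  have hsurj : Function.Surjective (B.mat i).mulVecLin := by
    rw [← LinearMap.range_eq_top]
    apply Submodule.eq_top_of_finrank_eq
    simpa [Matrix.rank] using B.rank_mat i
  obtain ⟨c, -, hc⟩ := (B.mat i).mulVecLin.exists_map_addHaar_eq_smul_addHaar
    (volume : Measure (ι → ℝ)) (volume : Measure (Fin (B.dim i) → ℝ)) hsurj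
  have h1 : μ ≪ (volume : Measure (ι → ℝ)) := hμ.trans Measure.smul_absolutelyContinuous
  have h2 : (volume : Measure (Fin (B.dim i) → ℝ)) ≪ refMeasure _ := by
    refine Measure.absolutelyContinuous_smul ?_
    rw [Ne, ENNReal.ofReal_eq_zero, not_le]
    positivity
  refine (h1.map (measurable_mulVec (B.mat i))).trans (.trans ?_ h2)
  change Measure.map (B.mat i).mulVecLin volume ≪ _
  rw [hc]
  exact Measure.smul_absolutelyContinuous

lemma entropyPos_law (μ : Measure (ι → ℝ)) (i : Fin K) : entropyPos (B.law μ i) =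
    ∫⁻ x, ENNReal.ofReal (negLogDensity (B.law μ i) (B.mat i *ᵥ x)) ∂μ :=
  lintegral_map (measurable_negLogDensity _).ennreal_ofReal (measurable_mulVec _)

lemma entropyNeg_law (μ : Measure (ι → ℝ)) (i : Fin K) : entropyNeg (B.law μ i) =
    ∫⁻ x, ENNReal.ofReal (-negLogDensity (B.law μ i) (B.mat i *ᵥ x)) ∂μ :=
  lintegral_map (measurable_negLogDensity _).neg.ennreal_ofReal (measurable_mulVec _)

/-- The integrand of the exponential moment is the product of the marginal densities to the powers
`p i`, divided by the density of `μ`; so the integral is at most the left-hand side of the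
functional inequality for the marginal densities. -/
lemma lintegral_exp_le_one {p : Fin K → ℝ≥0} {C : ℝ}
    (H : ∀ f : (i : Fin K) → (Fin (B.dim i) → ℝ) → ℝ≥0∞, (∀ i, Measurable (f i)) →
      ∫⁻ x, ∏ i, f i (B.mat i *ᵥ x) ^ (p i : ℝ) ∂refMeasure ι ≤
        ENNReal.ofReal (Real.exp C) * ∏ i, (∫⁻ y, f i y ∂refMeasure _) ^ (p i : ℝ))
    {μ : Measure (ι → ℝ)} [IsProbabilityMeasure μ] (hμ : μ ≪ refMeasure ι) :
    ∫⁻ x, ENNReal.ofReal (Real.exp (negLogDensity μ x -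
      ∑ i, (p i : ℝ) * negLogDensity (B.law μ i) (B.mat i *ᵥ x) - C)) ∂μ ≤ 1 := by
  have hlaw (i : Fin K) : IsProbabilityMeasure (B.law μ i) :=
    Measure.isProbabilityMeasure_map (measurable_mulVec _).aemeasurable
  -- The hypothesis is used for `q i`, the density of the law of `B i X`.
  set q : (i : Fin K) → (Fin (B.dim i) → ℝ) → ℝ≥0∞ := fun i =>
    (B.law μ i).rnDeriv (refMeasure _)
  have hqm (i : Fin K) : Measurable (q i) := Measure.measurable_rnDeriv _ _
  have hpos : ∀ᵐ x ∂μ, 0 < μ.rnDeriv (refMeasure ι) x := Measure.rnDeriv_pos hμ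
  have hfin : ∀ᵐ x ∂μ, μ.rnDeriv (refMeasure ι) x < ∞ :=
    hμ.ae_le (Measure.rnDeriv_lt_top _ _)
  have hqpos : ∀ᵐ x ∂μ, ∀ i, 0 < q i (B.mat i *ᵥ x) := by
    rw [ae_all_iff]
    exact fun i => ae_of_ae_map (measurable_mulVec _).aemeasurable
      (Measure.rnDeriv_pos (B.law_absolutelyContinuous hμ i))
  have hqfin : ∀ᵐ x ∂μ, ∀ i, q i (B.mat i *ᵥ x) < ∞ := by
    rw [ae_all_iff]
    exact fun i => ae_of_ae_map (measurable_mulVec _).aemeasurable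
      ((B.law_absolutelyContinuous hμ i).ae_le (Measure.rnDeriv_lt_top _ _))
  set F : (ι → ℝ) → ℝ≥0∞ := fun x => ∏ i, q i (B.mat i *ᵥ x) ^ (p i : ℝ) with hF
  have hFm : Measurable F := Finset.measurable_prod _ fun i _ =>
    ((hqm i).comp (measurable_mulVec _)).pow_const _
  have hrm : Measurable (μ.rnDeriv (refMeasure ι)) := Measure.measurable_rnDeriv _ _
  have key : ∀ᵐ x ∂μ, ENNReal.ofReal (Real.exp (negLogDensity μ x -
      ∑ i, (p i : ℝ) * negLogDensity (B.law μ i) (B.mat i *ᵥ x) - C)) =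
      (μ.rnDeriv (refMeasure ι) x)⁻¹ * (F x * ENNReal.ofReal (Real.exp (-C))) := by
    filter_upwards [hpos, hfin, hqpos, hqfin] with x h1 h2 h3 h4
    have e1 : ENNReal.ofReal (Real.exp (negLogDensity μ x)) =
        (μ.rnDeriv (refMeasure ι) x)⁻¹ := by
      have := ENNReal.toReal_pos h1.ne' h2.ne
      rw [negLogDensity, Real.exp_neg, Real.exp_log this, ENNReal.ofReal_inv_of_pos this,
        ENNReal.ofReal_toReal h2.ne]
    have e2 (i : Fin K) : ENNReal.ofReal (Real.exp (-((p i : ℝ) *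
        negLogDensity (B.law μ i) (B.mat i *ᵥ x)))) = q i (B.mat i *ᵥ x) ^ (p i : ℝ) := by
      have := ENNReal.toReal_pos (h3 i).ne' (h4 i).ne
      rw [negLogDensity, mul_neg, neg_neg, mul_comm, Real.exp_mul, Real.exp_log this,
        ← ENNReal.ofReal_rpow_of_pos this, ENNReal.ofReal_toReal (h4 i).ne]
    rw [sub_eq_add_neg, sub_eq_add_neg, Real.exp_add, Real.exp_add, ← Finset.sum_neg_distrib,
      Real.exp_sum, mul_assoc, ENNReal.ofReal_mul (Real.exp_pos _).le,
      ENNReal.ofReal_mul (Finset.prod_nonneg fun i _ => (Real.exp_pos _).le),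
      ENNReal.ofReal_prod_of_nonneg (fun i _ => (Real.exp_pos _).le), e1]
    simp only [e2, hF]
  rw [lintegral_congr_ae key, ← lintegral_rnDeriv_mul hμ (by fun_prop)]
  calc _ ≤ ∫⁻ x, F x * ENNReal.ofReal (Real.exp (-C)) ∂refMeasure ι := by
        refine lintegral_mono fun x => ?_
        rw [← mul_assoc]
        exact (mul_le_mul_left (ENNReal.mul_inv_le_one _) _).trans_eq (one_mul _)
    _ = (∫⁻ x, F x ∂refMeasure ι) * ENNReal.ofReal (Real.exp (-C)) := lintegral_mul_const _ hFm
    _ ≤ (ENNReal.ofReal (Real.exp C) * 1) * ENNReal.ofReal (Real.exp (-C)) := by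
        refine mul_le_mul_left ((H q hqm).trans (mul_le_mul_right ?_ _)) _
        refine Finset.prod_le_one' fun i _ => ENNReal.rpow_le_one ?_ (p i).2
        exact (Measure.lintegral_rnDeriv_le).trans_eq measure_univ
    _ = 1 := by
        rw [mul_one, ← ENNReal.ofReal_mul (Real.exp_pos _).le, ← Real.exp_add]
        simp

/-- Duality: a Brascamp–Lieb inequality for functions bounds the entropic Brascamp–Lieb constant.
It is applied to the marginal densities, and Jensen's inequality for the logarithm does the rest. -/
theorem constant_le_of_lintegral_le {p : Fin K → ℝ≥0} (hp : ∀ i, p i ≠ 0) {C : ℝ}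
    (H : ∀ f : (i : Fin K) → (Fin (B.dim i) → ℝ) → ℝ≥0∞, (∀ i, Measurable (f i)) →
      ∫⁻ x, ∏ i, f i (B.mat i *ᵥ x) ^ (p i : ℝ) ∂refMeasure ι ≤
        ENNReal.ofReal (Real.exp C) * ∏ i, (∫⁻ y, f i y ∂refMeasure _) ^ (p i : ℝ)) :
    B.constant p ≤ C := by
  refine iSup₂_le fun μ hμ => ?_
  obtain ⟨⟨hprob, hac, hP, hN⟩, hadm⟩ := hμ
  have hexp := B.lintegral_exp_le_one H hac
  have hint := integrable_of_lintegral_ofReal_ne_top (measurable_negLogDensity μ) hP hN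
  have ham (i : Fin K) : Measurable fun x => negLogDensity (B.law μ i) (B.mat i *ᵥ x) :=
    (measurable_negLogDensity _).comp (measurable_mulVec _)
  have finite_case (h₁ : ∀ i, entropyPos (B.law μ i) ≠ ∞)
      (h₂ : ∀ i, entropyNeg (B.law μ i) ≠ ∞) :
      entropy μ - ∑ i, ((p i : ℝ) : EReal) * entropy (B.law μ i) ≤ C := by
    have := integral_sub_sum_le (fun i => integrable_of_lintegral_ofReal_ne_top (ham i)
      (by rw [← entropyPos_law]; exact h₁ i) (by rw [← entropyNeg_law]; exact h₂ i)) hint hexp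
    have e (i : Fin K) : entropy (B.law μ i) =
        ((∫ x, negLogDensity (B.law μ i) (B.mat i *ᵥ x) ∂μ : ℝ) : EReal) := by
      rw [entropy_eq_integral (h₁ i) (h₂ i)]
      congr 1
      exact integral_map (measurable_mulVec _).aemeasurable
        (measurable_negLogDensity _).aestronglyMeasurable
    simp only [e, entropy_eq_integral hP hN, ← EReal.coe_mul]
    rw [← EReal_coe_sum, ← EReal.coe_sub]
    exact EReal.coe_le_coe this
  rcases hadm with hadm | hadm
  · have hadm' (i : Fin K) := hadm i (hp i)
    refine finite_case hadm' fun j => ?_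
    rw [entropyNeg_law]
    exact lintegral_ofReal_neg_ne_top hp ham hint (measurable_negLogDensity μ) hexp
      (fun i => by rw [← entropyPos_law]; exact hadm' i) j
  · by_cases h : ∀ i, entropyPos (B.law μ i) ≠ ∞
    · exact finite_case h fun i => hadm i (hp i)
    · -- Some `S(B j X)` is `+∞` and none is `-∞`, so the difference of entropies is `-∞`.
      push Not at h
      obtain ⟨j, hj⟩ := h
      have hpi (i : Fin K) : 0 < (p i : ℝ) := by exact_mod_cast pos_iff_ne_zero.2 (hp i)
      have hne (i : Fin K) : entropy (B.law μ i) ≠ ⊥ := by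
        rw [entropy, ← EReal.coe_ennreal_toReal (hadm i (hp i)), sub_eq_add_neg, Ne,
          EReal.add_eq_bot_iff, not_or]
        exact ⟨EReal.coe_ennreal_ne_bot _, by rw [← EReal.coe_neg]; exact EReal.coe_ne_bot _⟩
      have htop : entropy (B.law μ j) = ⊤ := by
        rw [entropy, hj, ← EReal.coe_ennreal_toReal (hadm j (hp j)), EReal.coe_ennreal_top,
          EReal.top_sub_coe]
      rw [EReal_sum_eq_top (fun i _ => ?_) (Finset.mem_univ j), entropy_eq_integral hP hN]
      · simp
      · rw [htop, EReal.coe_mul_top_of_pos (hpi j)]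
      · rw [Ne, EReal.mul_eq_bot]
        push Not
        have := hpi i
        refine ⟨by simp, fun _ => hne i, by simp, fun h => absurd h ?_⟩
        simp

end Datum

end BrascampLieb

/-! ### Linear changes of variables and the Cauchy–Schwarz inequality -/

namespace BrascampLieb

lemma lintegral_refMeasure_comp_mulVec {ι : Type} [Fintype ι] [DecidableEq ι] {M : Matrix ι ι ℝ}
    (hM : M.det ≠ 0) {f : (ι → ℝ) → ℝ≥0∞} (hf : Measurable f) :
    ∫⁻ x, f (M *ᵥ x) ∂refMeasure ι =
      ENNReal.ofReal |M.det⁻¹| * ∫⁻ y, f y ∂refMeasure ι := by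
  have h := Real.map_matrix_volume_pi_eq_smul_volume_pi hM
  have h' : ∫⁻ x, f (M *ᵥ x) = ENNReal.ofReal |M.det⁻¹| * ∫⁻ y, f y := by
    rw [← smul_eq_mul, ← lintegral_smul_measure, ← h,
      lintegral_map hf (Matrix.toLin' M).continuous_of_finiteDimensional.measurable]
    rfl
  simp only [refMeasure, lintegral_smul_measure, h', smul_eq_mul]
  ring

/-- The reference measure is multiplicative, because its constant depends exponentially on the
dimension. -/
lemma lintegral_refMeasure_sum {α β : Type} [Fintype α] [Fintype β]
    {f : (α → ℝ) → ℝ≥0∞} {g : (β → ℝ) → ℝ≥0∞} (hf : Measurable f) (hg : Measurable g) :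
    ∫⁻ x, f (x ∘ Sum.inl) * g (x ∘ Sum.inr) ∂refMeasure (α ⊕ β) =
      (∫⁻ y, f y ∂refMeasure α) * ∫⁻ z, g z ∂refMeasure β := by
  have h : ∫⁻ x : α ⊕ β → ℝ, f (x ∘ Sum.inl) * g (x ∘ Sum.inr) =
      (∫⁻ y, f y) * ∫⁻ z, g z := by
    rw [← lintegral_prod_mul hf.aemeasurable hg.aemeasurable]
    exact (volume_measurePreserving_sumPiEquivProdPi fun _ : α ⊕ β => ℝ).lintegral_comp
      (f := fun z => f z.1 * g z.2) (by fun_prop)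
  have hc : ENNReal.ofReal ((2 * Real.pi) ^ (-(Fintype.card (α ⊕ β) : ℝ) / 2)) =
      ENNReal.ofReal ((2 * Real.pi) ^ (-(Fintype.card α : ℝ) / 2)) *
        ENNReal.ofReal ((2 * Real.pi) ^ (-(Fintype.card β : ℝ) / 2)) := by
    rw [← ENNReal.ofReal_mul (by positivity), ← Real.rpow_add (by positivity),
      Fintype.card_sum, Nat.cast_add]
    congr 2
    ring
  simp only [refMeasure, lintegral_smul_measure, h, smul_eq_mul, hc]
  ring

/-- `x ↦ (A₁ x, A₂ x)` maps the reference measure to `c` times the product of the reference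
measures; that is, it is a linear change of variables whose inverse has Jacobian `c`. -/
def Splits {ι α β : Type} [Fintype ι] [Fintype α] [Fintype β] (A₁ : Matrix α ι ℝ)
    (A₂ : Matrix β ι ℝ) (c : ℝ) : Prop :=
  ∀ ⦃f : (α → ℝ) → ℝ≥0∞⦄ ⦃g : (β → ℝ) → ℝ≥0∞⦄, Measurable f → Measurable g →
    ∫⁻ x, f (A₁ *ᵥ x) * g (A₂ *ᵥ x) ∂refMeasure ι =
      ENNReal.ofReal c * ((∫⁻ y, f y ∂refMeasure α) * ∫⁻ z, g z ∂refMeasure β)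

namespace Splits

variable {ι α β α' β' : Type} [Fintype ι] [Fintype α] [Fintype β] [Fintype α'] [Fintype β']
  {A₁ : Matrix α ι ℝ} {A₂ : Matrix β ι ℝ} {A₁' : Matrix α' ι ℝ} {A₂' : Matrix β' ι ℝ} {c c' : ℝ}

lemma symm (h : Splits A₁ A₂ c) : Splits A₂ A₁ c := fun f g hf hg => by
  simpa only [mul_comm] using h hg hf

lemma of_det_ne_zero [DecidableEq α] [DecidableEq β] {A₁ : Matrix α (α ⊕ β) ℝ}
    {A₂ : Matrix β (α ⊕ β) ℝ} (h : (Matrix.fromRows A₁ A₂).det ≠ 0) :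
    Splits A₁ A₂ |(Matrix.fromRows A₁ A₂).det⁻¹| := fun f g hf hg => by
  rw [← lintegral_refMeasure_sum hf hg, ← lintegral_refMeasure_comp_mulVec h
    (f := fun x => f (x ∘ Sum.inl) * g (x ∘ Sum.inr)) (by fun_prop)]
  simp only [Matrix.fromRows_mulVec, Sum.elim_comp_inl, Sum.elim_comp_inr]

/-- Cauchy–Schwarz for the two factors `√(f₁(A₁ x) f₂(A₂ x))` and `√(f₁'(A₁' x) f₂'(A₂' x))`,
whose `L²` norms are explicit. -/
lemma lintegral_sqrt_mul_le (h : Splits A₁ A₂ c) (h' : Splits A₁' A₂' c')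
    {f₁ : (α → ℝ) → ℝ≥0∞} {f₂ : (β → ℝ) → ℝ≥0∞} {f₁' : (α' → ℝ) → ℝ≥0∞}
    {f₂' : (β' → ℝ) → ℝ≥0∞} (hf₁ : Measurable f₁) (hf₂ : Measurable f₂) (hf₁' : Measurable f₁')
    (hf₂' : Measurable f₂') :
    ∫⁻ x, (f₁ (A₁ *ᵥ x) * f₂ (A₂ *ᵥ x)) ^ (1 / 2 : ℝ) *
        (f₁' (A₁' *ᵥ x) * f₂' (A₂' *ᵥ x)) ^ (1 / 2 : ℝ) ∂refMeasure ι ≤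
      (ENNReal.ofReal c * ((∫⁻ y, f₁ y ∂refMeasure α) * ∫⁻ y, f₂ y ∂refMeasure β)) ^
          (1 / 2 : ℝ) *
        (ENNReal.ofReal c' * ((∫⁻ y, f₁' y ∂refMeasure α') * ∫⁻ y, f₂' y ∂refMeasure β')) ^
          (1 / 2 : ℝ) := by
  have m₁ := hf₁.comp (measurable_mulVec A₁)
  have m₂ := hf₂.comp (measurable_mulVec A₂)
  have m₁' := hf₁'.comp (measurable_mulVec A₁')
  have m₂' := hf₂'.comp (measurable_mulVec A₂')
  rw [← h hf₁ hf₂, ← h' hf₁' hf₂']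
  have := ENNReal.lintegral_mul_le_Lp_mul_Lq (refMeasure ι) Real.HolderConjugate.two_two
    (f := fun x => (f₁ (A₁ *ᵥ x) * f₂ (A₂ *ᵥ x)) ^ (1 / 2 : ℝ))
    (g := fun x => (f₁' (A₁' *ᵥ x) * f₂' (A₂' *ᵥ x)) ^ (1 / 2 : ℝ))
    ((m₁.mul m₂).pow_const _).aemeasurable ((m₁'.mul m₂').pow_const _).aemeasurable
  simp only [← ENNReal.rpow_mul] at this
  norm_num at this ⊢
  exact this

end Splits

end BrascampLieb

/-! ### Gaussian laws and Schur complements -/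

namespace BrascampLieb

section Gaussian

variable {ι : Type} [Fintype ι]

/-- The quadratic form `x ↦ xᵀ P x`. -/
def quad (P : Matrix ι ι ℝ) (x : ι → ℝ) : ℝ := x ⬝ᵥ P *ᵥ x

lemma measurable_quad (P : Matrix ι ι ℝ) : Measurable (quad P) := by
  unfold quad Matrix.mulVec dotProduct
  fun_prop

lemma quad_nonneg {P : Matrix ι ι ℝ} (hP : P.PosDef) (x : ι → ℝ) : 0 ≤ quad P x := by
  simpa [quad] using hP.posSemidef.dotProduct_mulVec_nonneg x

lemma lintegral_exp_neg_quad_one [DecidableEq ι] :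
    ∫⁻ x, ENNReal.ofReal (Real.exp (-quad (1 : Matrix ι ι ℝ) x / 2)) ∂refMeasure ι = 1 := by
  have h (x : ι → ℝ) : Real.exp (-quad (1 : Matrix ι ι ℝ) x / 2) =
      ∏ i, Real.exp (-(1 / 2) * x i ^ 2) := by
    rw [← Real.exp_sum, ← Finset.mul_sum, quad, Matrix.one_mulVec, dotProduct]
    simp only [pow_two]
    congr 1
    ring
  have hint : Integrable (fun x : ι → ℝ => ∏ i, Real.exp (-(1 / 2) * x i ^ 2)) :=
    Integrable.fintype_prod (f := fun _ t => Real.exp (-(1 / 2) * t ^ 2))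
      fun _ => integrable_exp_neg_mul_sq (by norm_num)
  simp only [h, refMeasure, lintegral_smul_measure]
  rw [← ofReal_integral_eq_lintegral_ofReal hint
      (.of_forall fun x => Finset.prod_nonneg fun i _ => (Real.exp_pos _).le),
    integral_fintype_prod_volume_eq_prod (fun _ t => Real.exp (-(1 / 2) * t ^ 2)), smul_eq_mul,
    ← ENNReal.ofReal_mul (by positivity)]
  simp only [integral_gaussian, Finset.prod_const, Finset.card_univ]
  rw [Real.sqrt_eq_rpow, ← Real.rpow_natCast, ← Real.rpow_mul (by positivity),
    show Real.pi / (1 / 2) = 2 * Real.pi by ring, ← Real.rpow_add (by positivity)]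
  ring_nf
  simp

open scoped MatrixOrder in
lemma lintegral_exp_neg_quad [DecidableEq ι] {P : Matrix ι ι ℝ} (hP : P.PosDef) :
    ∫⁻ x, ENNReal.ofReal (Real.exp (-quad P x / 2)) ∂refMeasure ι =
      ENNReal.ofReal (√P.det)⁻¹ := by
  obtain ⟨T, hT, rfl⟩ := CStarAlgebra.isStrictlyPositive_iff_eq_star_mul_self.1
    (Matrix.isStrictlyPositive_iff_posDef.2 hP)
  have hdet : T.det ≠ 0 := ((Matrix.isUnit_iff_isUnit_det T).1 hT).ne_zero
  have hq (x : ι → ℝ) : quad (star T * T) x = quad 1 (T *ᵥ x) := by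
    rw [quad, quad, Matrix.one_mulVec, ← Matrix.mulVec_mulVec, Matrix.dotProduct_mulVec,
      Matrix.star_eq_conjTranspose, Matrix.conjTranspose_eq_transpose_of_trivial,
      Matrix.vecMul_transpose]
  simp only [hq]
  rw [lintegral_refMeasure_comp_mulVec hdet
    (f := fun x => ENNReal.ofReal (Real.exp (-quad (1 : Matrix ι ι ℝ) x / 2)))
    (((measurable_quad _).neg.div_const _).exp.ennreal_ofReal), lintegral_exp_neg_quad_one,
    mul_one, Matrix.det_mul, Matrix.star_eq_conjTranspose,
    Matrix.conjTranspose_eq_transpose_of_trivial, Matrix.det_transpose, Real.sqrt_mul_self_eq_abs,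
    abs_inv]

variable [DecidableEq ι]

/-- The density, with respect to `refMeasure`, of the centred Gaussian law with precision
matrix (inverse covariance matrix) `P`. -/
noncomputable def gaussianDensity (P : Matrix ι ι ℝ) (x : ι → ℝ) : ℝ :=
  √P.det * Real.exp (-quad P x / 2)

/-- The centred Gaussian law with precision matrix (inverse covariance matrix) `P`. -/
noncomputable def gaussian (P : Matrix ι ι ℝ) : Measure (ι → ℝ) :=
  (refMeasure ι).withDensity fun x => ENNReal.ofReal (gaussianDensity P x)

lemma measurable_gaussianDensity (P : Matrix ι ι ℝ) : Measurable (gaussianDensity P) :=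
  ((measurable_quad _).neg.div_const _).exp.const_mul _

lemma lintegral_gaussian (P : Matrix ι ι ℝ) {f : (ι → ℝ) → ℝ≥0∞} (hf : Measurable f) :
    ∫⁻ x, f x ∂gaussian P = ENNReal.ofReal (√P.det) *
      ∫⁻ x, ENNReal.ofReal (Real.exp (-quad P x / 2)) * f x ∂refMeasure ι := by
  rw [gaussian, lintegral_withDensity_eq_lintegral_mul _
    (measurable_gaussianDensity P).ennreal_ofReal hf, ← lintegral_const_mul' _ _ ENNReal.ofReal_ne_top]
  refine lintegral_congr fun x => ?_
  rw [Pi.mul_apply, gaussianDensity, ENNReal.ofReal_mul (Real.sqrt_nonneg _), mul_assoc]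

lemma isProbabilityMeasure_gaussian {P : Matrix ι ι ℝ} (hP : P.PosDef) :
    IsProbabilityMeasure (gaussian P) := by
  refine ⟨?_⟩
  rw [← lintegral_one, lintegral_gaussian P measurable_const]
  simp only [mul_one]
  rw [lintegral_exp_neg_quad hP, ← ENNReal.ofReal_mul (Real.sqrt_nonneg _),
    mul_inv_cancel₀ (Real.sqrt_ne_zero'.2 hP.det_pos), ENNReal.ofReal_one]

lemma gaussian_absolutelyContinuous (P : Matrix ι ι ℝ) : gaussian P ≪ refMeasure ι :=
  withDensity_absolutelyContinuous _ _

lemma negLogDensity_gaussian {P : Matrix ι ι ℝ} (hP : P.PosDef) :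
    negLogDensity (gaussian P) =ᵐ[gaussian P] fun x => quad P x / 2 - Real.log P.det / 2 := by
  filter_upwards [(gaussian_absolutelyContinuous P).ae_le
    (Measure.rnDeriv_withDensity (refMeasure ι) (measurable_gaussianDensity P).ennreal_ofReal)]
    with x hx
  have hd := hP.det_pos
  rw [negLogDensity, gaussian, hx, ENNReal.toReal_ofReal (by unfold gaussianDensity; positivity),
    gaussianDensity, Real.log_mul (by positivity) (by positivity), Real.log_exp,
    Real.log_sqrt hd.le]
  ring

/-- The bound `t e^{-t} ≤ 2 e^{-t/2}` reduces the integral to the total mass of the Gaussian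
weight of `P / 2`. -/
lemma integrable_quad_gaussian {P : Matrix ι ι ℝ} (hP : P.PosDef) :
    Integrable (quad P) (gaussian P) := by
  refine ⟨(measurable_quad P).aestronglyMeasurable, ?_⟩
  rw [hasFiniteIntegral_iff_ofReal (.of_forall (quad_nonneg hP)),
    lintegral_gaussian P (measurable_quad P).ennreal_ofReal]
  refine ENNReal.mul_lt_top ENNReal.ofReal_lt_top ?_
  have hhalf : ((1 / 2 : ℝ) • P).PosDef := hP.smul (by norm_num)
  have hle (x : ι → ℝ) : ENNReal.ofReal (Real.exp (-quad P x / 2)) * ENNReal.ofReal (quad P x) ≤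
      ENNReal.ofReal 4 * ENNReal.ofReal (Real.exp (-quad ((1 / 2 : ℝ) • P) x / 2)) := by
    rw [← ENNReal.ofReal_mul (Real.exp_pos _).le, ← ENNReal.ofReal_mul (by norm_num)]
    refine ENNReal.ofReal_le_ofReal ?_
    have hq : quad ((1 / 2 : ℝ) • P) x = quad P x / 2 := by
      rw [quad, Matrix.smul_mulVec, dotProduct_smul, smul_eq_mul, quad]
      ring
    rw [hq, show -quad P x / 2 = -(quad P x / 2) / 2 + -(quad P x / 4) by ring, Real.exp_add,
      mul_assoc, mul_comm]
    refine mul_le_mul_of_nonneg_right ?_ (Real.exp_pos _).le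
    have h1 := Real.add_one_le_exp (quad P x / 4)
    rw [Real.exp_neg, inv_mul_le_iff₀ (Real.exp_pos _)]
    linarith
  refine (lintegral_mono hle).trans_lt ?_
  rw [lintegral_const_mul' _ _ ENNReal.ofReal_ne_top, lintegral_exp_neg_quad hhalf]
  exact ENNReal.mul_lt_top ENNReal.ofReal_lt_top ENNReal.ofReal_lt_top

lemma integrable_negLogDensity_gaussian {P : Matrix ι ι ℝ} (hP : P.PosDef) :
    Integrable (negLogDensity (gaussian P)) (gaussian P) := by
  have := isProbabilityMeasure_gaussian hP
  exact (((integrable_quad_gaussian hP).div_const 2).sub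
    (integrable_const (Real.log P.det / 2))).congr (negLogDensity_gaussian hP).symm

lemma hasFiniteEntropy_gaussian {P : Matrix ι ι ℝ} (hP : P.PosDef) :
    HasFiniteEntropy (gaussian P) where
  isProbabilityMeasure := isProbabilityMeasure_gaussian hP
  absolutelyContinuous := gaussian_absolutelyContinuous P
  entropyPos_ne_top := (integrable_negLogDensity_gaussian hP).lintegral_lt_top.ne
  entropyNeg_ne_top := (integrable_negLogDensity_gaussian hP).neg.lintegral_lt_top.ne

lemma entropy_gaussian {P : Matrix ι ι ℝ} (hP : P.PosDef) :
    entropy (gaussian P) =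
      (((∫ x, quad P x ∂gaussian P) / 2 - Real.log P.det / 2 : ℝ) : EReal) := by
  have := isProbabilityMeasure_gaussian hP
  rw [entropy_eq_integral (hasFiniteEntropy_gaussian hP).entropyPos_ne_top
    (hasFiniteEntropy_gaussian hP).entropyNeg_ne_top,
    integral_congr_ae (negLogDensity_gaussian hP),
    integral_sub ((integrable_quad_gaussian hP).div_const 2) (integrable_const _),
    integral_div, integral_const, probReal_univ, one_smul]

/-- If the quadratic form of `P` is the sum of those of `P₁` and `P₂` in complementary
coordinates, then these coordinates are independent under `gaussian P`. -/
lemma map_gaussian {α β : Type} [Fintype α] [Fintype β] [DecidableEq α] [DecidableEq β]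
    {A₁ : Matrix α ι ℝ} {A₂ : Matrix β ι ℝ} {c : ℝ} (hA : Splits A₁ A₂ c) {P : Matrix ι ι ℝ}
    {P₁ : Matrix α α ℝ} {P₂ : Matrix β β ℝ} (hP : P.PosDef) (hP₁ : P₁.PosDef)
    (hq : ∀ x, quad P x = quad P₁ (A₁ *ᵥ x) + quad P₂ (A₂ *ᵥ x)) :
    (gaussian P).map (A₁ *ᵥ ·) = gaussian P₁ := by
  have hprob := isProbabilityMeasure_gaussian hP
  have hprob₁ := isProbabilityMeasure_gaussian hP₁
  have hmap : IsProbabilityMeasure ((gaussian P).map (A₁ *ᵥ ·)) :=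
    Measure.isProbabilityMeasure_map (measurable_mulVec _).aemeasurable
  have hmexp {κ : Type} [Fintype κ] (Q : Matrix κ κ ℝ) :
      Measurable fun x => ENNReal.ofReal (Real.exp (-quad Q x / 2)) :=
    ((measurable_quad _).neg.div_const _).exp.ennreal_ofReal
  have hd : ENNReal.ofReal (√P₁.det) ≠ 0 := by
    simpa using hP₁.det_pos
  obtain ⟨k, hk⟩ : ∃ k : ℝ≥0∞, ∀ f : (α → ℝ) → ℝ≥0∞, Measurable f →
      ∫⁻ y, f y ∂(gaussian P).map (A₁ *ᵥ ·) = k * ∫⁻ y, f y ∂gaussian P₁ := by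
    refine ⟨ENNReal.ofReal (√P.det) * ENNReal.ofReal c *
      (∫⁻ z, ENNReal.ofReal (Real.exp (-quad P₂ z / 2)) ∂refMeasure β) *
      (ENNReal.ofReal (√P₁.det))⁻¹, fun f hf => ?_⟩
    have e (x : ι → ℝ) : ENNReal.ofReal (Real.exp (-quad P x / 2)) * f (A₁ *ᵥ x) =
        (ENNReal.ofReal (Real.exp (-quad P₁ (A₁ *ᵥ x) / 2)) * f (A₁ *ᵥ x)) *
          ENNReal.ofReal (Real.exp (-quad P₂ (A₂ *ᵥ x) / 2)) := by
      rw [hq, neg_add, add_div, Real.exp_add, ENNReal.ofReal_mul (Real.exp_pos _).le]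
      ring
    rw [lintegral_map hf (measurable_mulVec _),
      lintegral_gaussian P (f := fun x => f (A₁ *ᵥ x)) (hf.comp (measurable_mulVec _)), lintegral_gaussian P₁ hf]
    simp only [e]
    rw [hA (f := fun y => ENNReal.ofReal (Real.exp (-quad P₁ y / 2)) * f y)
      ((hmexp P₁).mul hf) (hmexp P₂)]
    rw [mul_assoc _ (ENNReal.ofReal √P₁.det)⁻¹, ← mul_assoc (ENNReal.ofReal √P₁.det)⁻¹,
      ENNReal.inv_mul_cancel hd ENNReal.ofReal_ne_top, one_mul]
    ring
  -- Both sides are probability measures, so the proportionality constant need not be computed.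
  have hk1 : k = 1 := by
    have := hk 1 measurable_one
    simpa using this.symm
  refine Measure.ext_of_lintegral _ fun f hf => ?_
  rw [hk f hf, hk1, one_mul]

lemma integral_quad_gaussian_eq_add {α β : Type} [Fintype α] [Fintype β] [DecidableEq α]
    [DecidableEq β] {A₁ : Matrix α ι ℝ} {A₂ : Matrix β ι ℝ} {P : Matrix ι ι ℝ} {P₁ : Matrix α α ℝ}
    {P₂ : Matrix β β ℝ} (hP₁ : P₁.PosDef) (hP₂ : P₂.PosDef)
    (h₁ : (gaussian P).map (A₁ *ᵥ ·) = gaussian P₁)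
    (h₂ : (gaussian P).map (A₂ *ᵥ ·) = gaussian P₂)
    (hq : ∀ x, quad P x = quad P₁ (A₁ *ᵥ x) + quad P₂ (A₂ *ᵥ x)) :
    ∫ x, quad P x ∂gaussian P =
      (∫ x, quad P₁ x ∂gaussian P₁) + ∫ x, quad P₂ x ∂gaussian P₂ := by
  have i₁ := integrable_quad_gaussian hP₁
  have i₂ := integrable_quad_gaussian hP₂
  rw [← h₁] at i₁ ⊢
  rw [← h₂] at i₂ ⊢
  have m₁ := (measurable_mulVec A₁).aemeasurable (μ := gaussian P)
  have m₂ := (measurable_mulVec A₂).aemeasurable (μ := gaussian P)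
  rw [integral_map m₁ i₁.1, integral_map m₂ i₂.1]
  exact (integral_congr_ae (.of_forall hq)).trans
    (integral_add (i₁.comp_aemeasurable m₁) (i₂.comp_aemeasurable m₂))

end Gaussian

section Schur

variable {α β : Type} [Fintype α] [Fintype β] [DecidableEq α] [DecidableEq β]
  {A : Matrix α α ℝ} {B : Matrix α β ℝ} {D : Matrix β β ℝ}

lemma quad_inv_mulVec {P : Matrix α α ℝ} (hP : P.PosDef) (x : α → ℝ) :
    quad P⁻¹ (P *ᵥ x) = quad P x := by
  rw [quad, quad, Matrix.mulVec_mulVec, Matrix.nonsing_inv_mul _ hP.det_pos.ne'.isUnit,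
    Matrix.one_mulVec, dotProduct_comm]

lemma quad_fromBlocks₂₂ (hD : D.PosDef) (x : α ⊕ β → ℝ) :
    quad (Matrix.fromBlocks A B Bᵀ D) x =
      quad (A - B * D⁻¹ * Bᵀ) ((Matrix.fromCols 1 0 : Matrix α (α ⊕ β) ℝ) *ᵥ x) +
        quad D⁻¹ (Matrix.fromCols Bᵀ D *ᵥ x) := by
  have hu := hD.det_pos.ne'.isUnit
  have : Invertible D := Matrix.invertibleOfIsUnitDet D hu
  obtain ⟨u, v, rfl⟩ : ∃ u v, x = Sum.elim u v := ⟨_, _, (Sum.elim_comp_inl_inr x).symm⟩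
  have h := Matrix.schur_complement_eq₂₂ A B u v hD.isHermitian
  rw [Matrix.conjTranspose_eq_transpose_of_trivial, ← Matrix.dotProduct_mulVec,
    ← Matrix.dotProduct_mulVec, ← Matrix.dotProduct_mulVec, star_trivial, star_trivial,
    star_trivial] at h
  have hw : Matrix.fromCols Bᵀ D *ᵥ Sum.elim u v = D *ᵥ ((D⁻¹ * Bᵀ) *ᵥ u + v) := by
    rw [Matrix.fromCols_mulVec_sumElim, Matrix.mulVec_add, Matrix.mulVec_mulVec,
      Matrix.mul_nonsing_inv_cancel_left _ _ hu]
  rw [hw, quad_inv_mulVec hD, Matrix.fromCols_mulVec_sumElim, Matrix.one_mulVec,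
    Matrix.zero_mulVec, add_zero, add_comm]
  exact h

lemma quad_fromBlocks₁₁ (hA : A.PosDef) (x : α ⊕ β → ℝ) :
    quad (Matrix.fromBlocks A B Bᵀ D) x =
      quad (D - Bᵀ * A⁻¹ * B) ((Matrix.fromCols 0 1 : Matrix β (α ⊕ β) ℝ) *ᵥ x) +
        quad A⁻¹ (Matrix.fromCols A B *ᵥ x) := by
  have hu := hA.det_pos.ne'.isUnit
  have : Invertible A := Matrix.invertibleOfIsUnitDet A hu
  obtain ⟨u, v, rfl⟩ : ∃ u v, x = Sum.elim u v := ⟨_, _, (Sum.elim_comp_inl_inr x).symm⟩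
  have h := Matrix.schur_complement_eq₁₁ B D u v hA.isHermitian
  rw [Matrix.conjTranspose_eq_transpose_of_trivial, ← Matrix.dotProduct_mulVec,
    ← Matrix.dotProduct_mulVec, ← Matrix.dotProduct_mulVec, star_trivial, star_trivial,
    star_trivial] at h
  have hw : Matrix.fromCols A B *ᵥ Sum.elim u v = A *ᵥ (u + (A⁻¹ * B) *ᵥ v) := by
    rw [Matrix.fromCols_mulVec_sumElim, Matrix.mulVec_add, Matrix.mulVec_mulVec,
      Matrix.mul_nonsing_inv_cancel_left _ _ hu]
  rw [hw, quad_inv_mulVec hA, Matrix.fromCols_mulVec_sumElim, Matrix.one_mulVec,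
    Matrix.zero_mulVec, zero_add, add_comm]
  exact h

lemma det_schur₂₂ (hD : D.PosDef) : (Matrix.fromBlocks A B Bᵀ D).det =
    D.det * (A - B * D⁻¹ * Bᵀ).det := by
  have : Invertible D := Matrix.invertibleOfIsUnitDet D hD.det_pos.ne'.isUnit
  rw [Matrix.det_fromBlocks₂₂, Matrix.invOf_eq_nonsing_inv]

lemma det_schur₁₁ (hA : A.PosDef) : (Matrix.fromBlocks A B Bᵀ D).det =
    A.det * (D - Bᵀ * A⁻¹ * B).det := by
  have : Invertible A := Matrix.invertibleOfIsUnitDet A hA.det_pos.ne'.isUnit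
  rw [Matrix.det_fromBlocks₁₁, Matrix.invOf_eq_nonsing_inv]

lemma posDef_schur₂₂ (hS : (Matrix.fromBlocks A B Bᵀ D).PosDef) (hD : D.PosDef) :
    (A - B * D⁻¹ * Bᵀ).PosDef := by
  have : Invertible D := Matrix.invertibleOfIsUnitDet D hD.det_pos.ne'.isUnit
  have h := (Matrix.PosDef.fromBlocks₂₂ A B hD).1
    (by simpa only [Matrix.conjTranspose_eq_transpose_of_trivial] using hS.posSemidef)
  rw [Matrix.conjTranspose_eq_transpose_of_trivial] at h
  rw [h.posDef_iff_det_ne_zero]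
  intro h0
  have := hS.det_pos
  rw [det_schur₂₂ hD, h0, mul_zero] at this
  exact this.false

lemma posDef_schur₁₁ (hS : (Matrix.fromBlocks A B Bᵀ D).PosDef) (hA : A.PosDef) :
    (D - Bᵀ * A⁻¹ * B).PosDef := by
  have : Invertible A := Matrix.invertibleOfIsUnitDet A hA.det_pos.ne'.isUnit
  have h := (Matrix.PosDef.fromBlocks₁₁ B D hA).1
    (by simpa only [Matrix.conjTranspose_eq_transpose_of_trivial] using hS.posSemidef)
  rw [Matrix.conjTranspose_eq_transpose_of_trivial] at h
  rw [h.posDef_iff_det_ne_zero]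
  intro h0
  have := hS.det_pos
  rw [det_schur₁₁ hA, h0, mul_zero] at this
  exact this.false

end Schur

end BrascampLieb

/-! ### The symplectic datum -/

namespace BrascampLieb

lemma IsSymplectic.det_eq_one {m₁ m₂ : ℕ}
    {S : Matrix (Fin (2 * m₁) ⊕ Fin (2 * m₂)) (Fin (2 * m₁) ⊕ Fin (2 * m₂)) ℝ}
    (hS : IsSymplectic S) (hpos : S.PosDef) : S.det = 1 := by
  have h1 : symplecticForm₂ m₁ m₂ * (symplecticForm₂ m₁ m₂)ᵀ = 1 := by
    simp [symplecticForm₂, Matrix.fromBlocks_transpose, Matrix.fromBlocks_multiply,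
      symplecticForm_mul_transpose]
  have hΔ : (symplecticForm₂ m₁ m₂).det ≠ 0 := fun h => by
    simpa [h] using congrArg Matrix.det h1
  have h2 := congrArg Matrix.det hS
  rw [Matrix.det_mul, Matrix.det_mul, Matrix.det_transpose] at h2
  have h3 : S.det ^ 2 = 1 := by
    apply mul_right_cancel₀ hΔ
    linarith
  nlinarith [hpos.det_pos]

section Blocks

variable {α β : Type} [Fintype α] [Fintype β] [DecidableEq α] [DecidableEq β]
  (A : Matrix α α ℝ) (B : Matrix α β ℝ) (C : Matrix β α ℝ) (D : Matrix β β ℝ)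

lemma splits_inl (hD : 0 < D.det) : Splits (Matrix.fromCols 1 0 : Matrix α (α ⊕ β) ℝ)
    (Matrix.fromCols C D) D.det⁻¹ := by
  have h : (Matrix.fromRows (Matrix.fromCols 1 0 : Matrix α (α ⊕ β) ℝ)
      (Matrix.fromCols C D)).det = D.det := by
    rw [Matrix.fromRows_fromCols_eq_fromBlocks, Matrix.det_fromBlocks_zero₁₂, Matrix.det_one,
      one_mul]
  have := Splits.of_det_ne_zero (h ▸ hD.ne')
  rwa [h, abs_of_pos (inv_pos.2 hD)] at this

lemma splits_inr (hA : 0 < A.det) : Splits (Matrix.fromCols A B)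
    (Matrix.fromCols 0 1 : Matrix β (α ⊕ β) ℝ) A.det⁻¹ := by
  have h : (Matrix.fromRows (Matrix.fromCols A B)
      (Matrix.fromCols 0 1 : Matrix β (α ⊕ β) ℝ)).det = A.det := by
    rw [Matrix.fromRows_fromCols_eq_fromBlocks, Matrix.det_fromBlocks_zero₂₁, Matrix.det_one,
      mul_one]
  have := Splits.of_det_ne_zero (h ▸ hA.ne')
  rwa [h, abs_of_pos (inv_pos.2 hA)] at this

end Blocks

section Symplectic

variable {m₁ m₂ : ℕ}
  {S : Matrix (Fin (2 * m₁) ⊕ Fin (2 * m₂)) (Fin (2 * m₁) ⊕ Fin (2 * m₂)) ℝ}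

lemma constant_symplecticDatum_le (hS : IsSymplectic S) (hA : 0 < S.toBlocks₁₁.det)
    (hD : 0 < S.toBlocks₂₂.det) :
    (symplecticDatum S hS).constant (fun _ => 1 / 2) ≤
      ((-(1 / 2) * Real.log (S.toBlocks₁₁.det * S.toBlocks₂₂.det) : ℝ) : EReal) := by
  -- `(B₁, B₂')` and `(B₁', B₂)` are the two complementary pairs of coordinates.
  refine (symplecticDatum S hS).constant_le_of_lintegral_le (fun _ => by simp) fun f hf => ?_
  have h := (splits_inl S.toBlocks₂₁ S.toBlocks₂₂ hD).lintegral_sqrt_mul_le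
    (splits_inr S.toBlocks₁₁ S.toBlocks₁₂ hA) (hf 0) (hf 3) (hf 2) (hf 1)
  have hhalf : ((1 / 2 : ℝ≥0) : ℝ) = 1 / 2 := by norm_num
  have hC : ENNReal.ofReal
        (Real.exp (-(1 / 2) * Real.log (S.toBlocks₁₁.det * S.toBlocks₂₂.det))) =
      ENNReal.ofReal S.toBlocks₂₂.det⁻¹ ^ (1 / 2 : ℝ) *
        ENNReal.ofReal S.toBlocks₁₁.det⁻¹ ^ (1 / 2 : ℝ) := by
    rw [← ENNReal.mul_rpow_of_nonneg _ _ (by norm_num), ← ENNReal.ofReal_mul (by positivity),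
      ENNReal.ofReal_rpow_of_pos (by positivity), Real.rpow_def_of_pos (by positivity),
      ← mul_inv_rev, Real.log_inv]
    congr 2
    ring
  rw [hC, hhalf]
  simp only [Fin.prod_univ_four]
  simp only [ENNReal.mul_rpow_of_nonneg _ _ (show (0 : ℝ) ≤ 1 / 2 by norm_num)] at h
  refine (lintegral_congr fun x => ?_).trans_le (h.trans_eq ?_)
  · have e (a b c d : ℝ≥0∞) : a * b * c * d = a * d * (c * b) := by ring
    exact e _ _ _ _
  · have e (a b c d s t : ℝ≥0∞) : s * (a * d) * (t * (c * b)) = s * t * (a * b * c * d) := by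
      ring
    exact e _ _ _ _ _ _

/-- The Gaussian law with precision matrix `S` attains the bound: under it `B₁ X` is independent of
`B₂' X` and `B₂ X` is independent of `B₁' X`, so that the product of the marginal densities is, up
to constants, the density of `X` for either pair; this is the equality case of the Cauchy–Schwarz
inequality. -/
lemma le_constant_symplecticDatum (hS : IsSymplectic S) (hsymm : S.IsSymm) (hpos : S.PosDef) :
    ((-(1 / 2) * Real.log (S.toBlocks₁₁.det * S.toBlocks₂₂.det) : ℝ) : EReal) ≤
      (symplecticDatum S hS).constant (fun _ => 1 / 2) := by
  set A := S.toBlocks₁₁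
  set B := S.toBlocks₁₂
  set C := S.toBlocks₂₁
  set D := S.toBlocks₂₂
  have hA : A.PosDef := hpos.submatrix Sum.inl_injective
  have hD : D.PosDef := hpos.submatrix Sum.inr_injective
  have hC : C = Bᵀ := by
    ext i j
    exact hsymm.apply _ _
  have hblocks : S = Matrix.fromBlocks A B Bᵀ D := by
    rw [← hC]
    exact (Matrix.fromBlocks_toBlocks S).symm
  have hpos' := hblocks ▸ hpos
  have hP₁ : (A - B * D⁻¹ * Bᵀ).PosDef := posDef_schur₂₂ hpos' hD
  have hP₂ : (D - Bᵀ * A⁻¹ * B).PosDef := posDef_schur₁₁ hpos' hA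
  set P₁ := A - B * D⁻¹ * Bᵀ
  set P₂ := D - Bᵀ * A⁻¹ * B
  have hdet : S.det = 1 := hS.det_eq_one hpos
  have hd₁ : D.det * P₁.det = 1 := by rw [← hdet, hblocks, det_schur₂₂ hD]
  have hd₂ : A.det * P₂.det = 1 := by rw [← hdet, hblocks, det_schur₁₁ hA]
  set E₁ : Matrix (Fin (2 * m₁)) (Fin (2 * m₁) ⊕ Fin (2 * m₂)) ℝ := Matrix.fromCols 1 0
  set E₂ : Matrix (Fin (2 * m₂)) (Fin (2 * m₁) ⊕ Fin (2 * m₂)) ℝ := Matrix.fromCols 0 1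
  have hq₁ (x) : quad S x = quad P₁ (E₁ *ᵥ x) + quad D⁻¹ (Matrix.fromCols C D *ᵥ x) := by
    rw [hblocks, hC, quad_fromBlocks₂₂ hD]
  have hq₂ (x) : quad S x = quad P₂ (E₂ *ᵥ x) + quad A⁻¹ (Matrix.fromCols A B *ᵥ x) := by
    rw [hblocks, quad_fromBlocks₁₁ hA]
  have s₁ := splits_inl C D hD.det_pos
  have s₂ := splits_inr A B hA.det_pos
  have l₀ : (gaussian S).map (E₁ *ᵥ ·) = gaussian P₁ := map_gaussian s₁ hpos hP₁ hq₁
  have l₃ : (gaussian S).map (Matrix.fromCols C D *ᵥ ·) = gaussian D⁻¹ :=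
    map_gaussian s₁.symm hpos hD.inv fun x => (hq₁ x).trans (add_comm _ _)
  have l₁ : (gaussian S).map (E₂ *ᵥ ·) = gaussian P₂ := map_gaussian s₂.symm hpos hP₂ hq₂
  have l₂ : (gaussian S).map (Matrix.fromCols A B *ᵥ ·) = gaussian A⁻¹ :=
    map_gaussian s₂ hpos hA.inv fun x => (hq₂ x).trans (add_comm _ _)
  have hadm : (symplecticDatum S hS).Admissible (fun _ => 1 / 2) (gaussian S) := by
    refine ⟨hasFiniteEntropy_gaussian hpos, Or.inl fun i _ => ?_⟩
    fin_cases i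
    · exact ne_of_eq_of_ne (congrArg entropyPos l₀) (hasFiniteEntropy_gaussian hP₁).entropyPos_ne_top
    · exact ne_of_eq_of_ne (congrArg entropyPos l₁) (hasFiniteEntropy_gaussian hP₂).entropyPos_ne_top
    · exact ne_of_eq_of_ne (congrArg entropyPos l₂) (hasFiniteEntropy_gaussian hA.inv).entropyPos_ne_top
    · exact ne_of_eq_of_ne (congrArg entropyPos l₃) (hasFiniteEntropy_gaussian hD.inv).entropyPos_ne_top
  refine le_trans (le_of_eq ?_) (le_iSup₂ (gaussian S) hadm)
  have e₀ : entropy ((symplecticDatum S hS).law (gaussian S) 0) = entropy (gaussian P₁) :=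
    congrArg entropy l₀
  have e₁ : entropy ((symplecticDatum S hS).law (gaussian S) 1) = entropy (gaussian P₂) :=
    congrArg entropy l₁
  have e₂ : entropy ((symplecticDatum S hS).law (gaussian S) 2) = entropy (gaussian A⁻¹) :=
    congrArg entropy l₂
  have e₃ : entropy ((symplecticDatum S hS).law (gaussian S) 3) = entropy (gaussian D⁻¹) :=
    congrArg entropy l₃
  have i₁ := integral_quad_gaussian_eq_add hP₁ hD.inv l₀ l₃ hq₁
  have i₂ := integral_quad_gaussian_eq_add hP₂ hA.inv l₁ l₂ hq₂
  have hhalf : ((1 / 2 : ℝ≥0) : ℝ) = 1 / 2 := by norm_num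
  rw [Fin.sum_univ_four, e₀, e₁, e₂, e₃, entropy_gaussian hpos, entropy_gaussian hP₁,
    entropy_gaussian hP₂, entropy_gaussian hA.inv, entropy_gaussian hD.inv, hhalf]
  simp only [← EReal.coe_mul, ← EReal.coe_add, ← EReal.coe_sub]
  congr 1
  have hlog₁ : Real.log P₁.det = -Real.log D.det := by
    rw [eq_inv_of_mul_eq_one_right hd₁, Real.log_inv]
  have hlog₂ : Real.log P₂.det = -Real.log A.det := by
    rw [eq_inv_of_mul_eq_one_right hd₂, Real.log_inv]
  rw [Real.log_mul hA.det_pos.ne' hD.det_pos.ne', hlog₁, hlog₂, hdet, Real.log_one,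
    Matrix.det_nonsing_inv, Matrix.det_nonsing_inv, Ring.inverse_eq_inv', Real.log_inv,
    Real.log_inv]
  linarith

end Symplectic

end BrascampLieb

theorem mainTheorem6 (m₁ m₂ : ℕ)
    (S : Matrix (Fin (2 * m₁) ⊕ Fin (2 * m₂)) (Fin (2 * m₁) ⊕ Fin (2 * m₂)) ℝ)
    (hS : BrascampLieb.IsSymplectic S) (hsymm : S.IsSymm) (hpos : S.PosDef) :
    (BrascampLieb.symplecticDatum S hS).constant (fun _ => 1 / 2) =
      ((-(1 / 2) * Real.log (S.toBlocks₁₁.det * S.toBlocks₂₂.det) : ℝ) : EReal) :=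
  le_antisymm
    (BrascampLieb.constant_symplecticDatum_le hS
      (hpos.submatrix Sum.inl_injective : S.toBlocks₁₁.PosDef).det_pos
      (hpos.submatrix Sum.inr_injective : S.toBlocks₂₂.PosDef).det_pos)
    (BrascampLieb.le_constant_symplecticDatum hS hsymm hpos)
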